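/- **Setting.** A *pointed monoid* is a commutative monoid $B$ with an absorbing element $0$; its ambient semiring $B^+$ consists of the finite formal sums $\sum a_i$ of elements of $B$, where $0\in B$ is identified with the empty sum. A *band* is a pointed monoid $B$ with a subset $N_B\subset B^+$ such that $0\in N_B$, $N_B+N_B=N_B$, $B\cdot N_B=N_B$, and such that for every $a\in B$ there is a unique $b\in B$ with $a+b\in N_B$. A *band morphism* is a multiplicative map preserving $0$, $1$ and sending null sums to null sums. For a multiplicative subset $S\subset B$, the band $S^{-1}B$ is the localization of the monoid, with the null set generated by the sums $\sum \frac{a_i}{1}$ with $\sum a_i\in N_B$; $B[h^{-1}]$ is the localization at the powers of $h$. An *$m$-ideal* of $B$ is a subset $I$ with $0\in I$ and $BI=I$; it is *prime* if $B\setminus I$ contains $1$ and is closed under multiplication. Let $\mathrm{BAff}$ be the opposite of the category of bands, with objects written $\operatorname{Spec}B$, and let a functor $X\mapsto |X|$ from $\mathrm{BAff}$ to topological spaces be given. For $h\in B$ let $\iota_h^*:U_h=\operatorname{Spec}B[h^{-1}]\to \operatorname{Spec}B$ be the morphism induced by localization; we also write $U_h$ for its image in $|\operatorname{Spec} B|$.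 A morphism $\varphi:U\to X$ in $\mathrm{BAff}$ is an *open immersion* ($U$ is an *affine open subscheme* of $X$) if $|\varphi|$ is an open topological embedding and every morphism $Y\to X$ in $\mathrm{BAff}$ whose image in $|X|$ is contained in the image of $|\varphi|$ factors uniquely through $\varphi$. A *covering family* of $X$ is a family $\{\varphi_i:U_i\to X\}_{i\in I}$ of open immersions whose images cover $|X|$. Consider the axioms: * (A1) For all $B$ and $h\in B$, $\iota_h^*$ is an open immersion; the sets $U_h$ ($h\in B$) form a basis of the topology of $|\operatorname{Spec}B|$; and every affine open subscheme $V\to\operatorname{Spec}B$ has a covering family $\{U_{h_i}\to V\}$ such that each composition $U_{h_i}\to V\to \operatorname{Spec}B$ is $\iota_{h_i}^*$. * (A2) If $\{U_i\to X\}$ is a covering family and $X'\to X$ is a morphism in $\mathrm{BAff}$, then $\{U_i\times_XX'\to X'\}$ is a covering family. * (A3) For every $Y$ in $\mathrm{BAff}$, the presheaf $\operatorname{Hom}(-,Y)$ satisfies the sheaf condition for every covering family. * (A4) Every irreducible closed subset of every $|X|$ is the closure of a unique point. **Proposition.** Assume (A1)–(A3). Then every affine open subscheme of $\operatorname{Spec}B$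 is principal open, i.e. isomorphic over $\operatorname{Spec}B$ to $U_h$ for some $h\in B$. A family $\{\varphi_i:U_i\to X\}_{i\in I}$ of open immersions is a covering family if and only if $\varphi_i$ is an isomorphism for some $i\in I$, or $I=\emptyset$ and $|X|=\emptyset$. **Theorem.** Assume (A1)–(A4) and that $|\operatorname{Spec}\mathbf 0|=\emptyset$ for the trivial band $\mathbf 0=\{0\}$. Let $X=\operatorname{Spec}B$. For $x\in |X|$ the set $S_x=\{h\in B\mid x\in U_h\}$ is a multiplicative subset of $B$; let $\iota_x:B\to B_x=S_x^{-1}B$ be the localization map and let $\Phi_X(x)=\iota_x^{-1}(B_x\setminus B_x^\times)$. Then $\Phi_X$ is a bijection from $|X|$ onto the set of prime $m$-ideals of $B$, and for every $h\in B$, $\Phi_X(U_h)$ is the set of all prime $m$-ideals $\mathfrak p$ of $B$ with $h\notin\mathfrak p$. -/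

import Mathlib

open CategoryTheory Opposite

universe u

namespace Bands

/-! ### Bands

Elements of the ambient semiring `B⁺` of a pointed monoid `B` are finite formal sums `∑ aᵢ` of
elements of `B`, where `0 ∈ B` is identified with the empty sum. Such a formal sum is written as a
`Multiset B`, and a subset of `B⁺` is a set of multisets to which membership does not change when
a summand `0` is inserted or deleted. -/

/-- Ideals of `B⁺`: the sets `I` of formal sums with `0 ∈ I`, `I + I = I` and `B · I = I`. -/
structure IsPlusIdeal {M : Type u} [CommMonoidWithZero M] (I : Set (Multiset M)) : Prop where
  zero_cons_mem_iff : ∀ s : Multiset M, (0 : M) ::ₘ s ∈ I ↔ s ∈ I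
  zero_mem : (0 : Multiset M) ∈ I
  add_mem : ∀ s ∈ I, ∀ t ∈ I, s + t ∈ I
  smul_mem : ∀ b : M, ∀ s ∈ I, s.map (fun a => b * a) ∈ I

/-- The ideal of `M⁺` generated by a set `G` of formal sums. -/
def plusIdealSpan {M : Type u} [CommMonoidWithZero M] (G : Set (Multiset M)) :
    Set (Multiset M) :=
  {s | ∀ I : Set (Multiset M), IsPlusIdeal I → G ⊆ I → s ∈ I}

/-- A band: a (commutative) pointed monoid `B` with an ideal `null` of `B⁺` (the null set) such that
for every `a` there is a unique `b` with `a + b` in the null set. -/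
class Band (B : Type u) extends CommMonoidWithZero B where
  null : Set (Multiset B)
  null_isPlusIdeal : IsPlusIdeal null
  existsUnique_neg : ∀ a : B, ∃! b : B, ({a, b} : Multiset B) ∈ null

/-- A band morphism: a multiplicative map preserving `0`, `1` and null sums. -/
@[ext]
structure BandHom (B C : Type u) [Band B] [Band C] where
  toHom : B →*₀ C
  map_null : ∀ s ∈ Band.null (B := B), s.map toHom ∈ Band.null (B := C)

/-- The category of bands. -/
structure BandCat : Type (u + 1) where
  carrier : Type u
  [band : Band carrier]

attribute [instance] BandCat.band

instance : Category.{u} BandCat.{u} where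
  Hom B C := BandHom B.carrier C.carrier
  id B := ⟨MonoidWithZeroHom.id _, fun s hs => by simpa using hs⟩
  comp f g := ⟨g.toHom.comp f.toHom, fun s hs => by
    have h := g.map_null _ (f.map_null s hs)
    rwa [Multiset.map_map] at h⟩

/-! ### Localizations -/

section Localization

variable {B : Type u} [Band B]

theorem plusIdealSpan_isPlusIdeal {M : Type u} [CommMonoidWithZero M] (G : Set (Multiset M)) :
    IsPlusIdeal (plusIdealSpan G) where
  zero_cons_mem_iff s := by
    constructor
    · intro h I hI hG
      exact (hI.zero_cons_mem_iff s).1 (h I hI hG)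
    · intro h I hI hG
      exact (hI.zero_cons_mem_iff s).2 (h I hI hG)
  zero_mem := fun I hI _ => hI.zero_mem
  add_mem := fun s hs t ht I hI hG => hI.add_mem s (hs I hI hG) t (ht I hI hG)
  smul_mem := fun b s hs I hI hG => hI.smul_mem b s (hs I hI hG)

theorem subset_plusIdealSpan {M : Type u} [CommMonoidWithZero M] (G : Set (Multiset M)) :
    G ⊆ plusIdealSpan G := fun _ hs _ _ hG => hG hs

/-- The map of pointed monoids `a ↦ a / 1` from `B` to `S⁻¹B`. -/
def locMap (S : Submonoid B) : B →*₀ Localization S where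
  toFun a := Localization.mk a 1
  map_zero' := Localization.mk_zero 1
  map_one' := Localization.mk_one
  map_mul' a b := by rw [Localization.mk_mul, one_mul]

theorem locMap_isUnit (S : Submonoid B) (s : S) : IsUnit (locMap S s) :=
  (Localization.monoidOf S).map_units s

theorem locMap_eq_zero {S : Submonoid B} {a : B} (h : locMap S a = 0) :
    ∃ c ∈ S, c * a = 0 := by
  have h' : Localization.monoidOf S a = Localization.monoidOf S 0 := by
    have h0 : locMap S a = locMap S 0 := by rw [h, map_zero]
    exact h0
  obtain ⟨c, hc⟩ := (Localization.monoidOf S).eq_iff_exists.1 h'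
  exact ⟨c, c.2, by simpa using hc⟩

/-- The null set of `S⁻¹B`: the ideal generated by all `∑ aᵢ / 1` with `∑ aᵢ` in the null set
of `B`. -/
def locNull (S : Submonoid B) : Set (Multiset (Localization S)) :=
  plusIdealSpan {t | ∃ s ∈ Band.null (B := B), t = s.map (locMap S)}

theorem exists_of_mem_locNull (S : Submonoid B) (t : Multiset (Localization S))
    (ht : t ∈ locNull S) : ∃ s ∈ S, ∃ n ∈ Band.null (B := B),
      n.map (locMap S) = t.map (fun x => locMap S s * x) := by
  have hN := Band.null_isPlusIdeal (B := B)
  refine ht {t | ∃ s ∈ S, ∃ n ∈ Band.null (B := B),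
      n.map (locMap S) = t.map (fun x => locMap S s * x)} ⟨?_, ?_, ?_, ?_⟩ ?_
  · intro t
    constructor
    · rintro ⟨s, hs, n, hn, h⟩
      classical
      rw [Multiset.map_cons, mul_zero] at h
      obtain ⟨z, hz, h0, h1⟩ := (Multiset.map_eq_cons _ _ _ _).2 h
      obtain ⟨c, hc, hcz⟩ := locMap_eq_zero h0
      obtain ⟨n', rfl⟩ := Multiset.exists_cons_of_mem hz
      refine ⟨c * s, S.mul_mem hc hs, n'.map (fun a => c * a), ?_, ?_⟩
      · have := hN.smul_mem c _ hn
        rw [Multiset.map_cons, hcz] at this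
        exact (hN.zero_cons_mem_iff _).1 this
      · rw [Multiset.erase_cons_head] at h1
        have h2 := congrArg (Multiset.map (fun x => locMap S c * x)) h1
        rw [Multiset.map_map, Multiset.map_map] at h2
        rw [Multiset.map_map]
        simpa [Function.comp_def, mul_assoc] using h2
    · rintro ⟨s, hs, n, hn, h⟩
      refine ⟨s, hs, 0 ::ₘ n, (hN.zero_cons_mem_iff _).2 hn, ?_⟩
      rw [Multiset.map_cons, Multiset.map_cons, h, mul_zero, map_zero]
  · exact ⟨1, S.one_mem, 0, hN.zero_mem, by simp⟩
  · rintro t₁ ⟨s₁, hs₁, n₁, hn₁, h₁⟩ t₂ ⟨s₂, hs₂, n₂, hn₂, h₂⟩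
    refine ⟨s₁ * s₂, S.mul_mem hs₁ hs₂, n₁.map (fun a => s₂ * a) + n₂.map (fun a => s₁ * a),
      hN.add_mem _ (hN.smul_mem _ _ hn₁) _ (hN.smul_mem _ _ hn₂), ?_⟩
    have h₁' := congrArg (Multiset.map (fun x => locMap S s₂ * x)) h₁
    have h₂' := congrArg (Multiset.map (fun x => locMap S s₁ * x)) h₂
    simp only [Multiset.map_map, Function.comp_def] at h₁' h₂'
    simp only [Multiset.map_add, Multiset.map_map, Function.comp_def, map_mul, h₁', h₂']
    congr 1 <;> refine Multiset.map_congr rfl fun x _ => ?_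
    · rw [← mul_assoc, mul_comm (locMap S s₂)]
    · rw [← mul_assoc]
  · rintro b t ⟨s, hs, n, hn, h⟩
    induction b using Localization.induction_on with
    | H y =>
      obtain ⟨b, v⟩ := y
      refine ⟨s * v, S.mul_mem hs v.2, n.map (fun a => b * a), hN.smul_mem _ _ hn, ?_⟩
      have hb : locMap S v * Localization.mk b v = locMap S b := by
        change Localization.mk _ _ * _ = Localization.mk _ _
        rw [Localization.mk_mul, Localization.mk_eq_mk_iff, Localization.r_iff_exists]
        exact ⟨1, by simp⟩
      have h' := congrArg (Multiset.map (fun x => locMap S b * x)) h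
      simp only [Multiset.map_map, Function.comp_def] at h'
      simp only [Multiset.map_map, Function.comp_def, map_mul, h']
      refine Multiset.map_congr rfl fun x _ => ?_
      rw [← hb]
      ac_rfl
  · rintro _ ⟨n, hn, rfl⟩
    exact ⟨1, S.one_mem, n, hn, by simp⟩

theorem exists_neg_one : ∃ e : B, ∀ a b : B,
    ({a, b} : Multiset B) ∈ Band.null (B := B) ↔ b = e * a := by
  have hN := Band.null_isPlusIdeal (B := B)
  obtain ⟨e, he, -⟩ := Band.existsUnique_neg (1 : B)
  have h : ∀ a : B, ({a, e * a} : Multiset B) ∈ Band.null (B := B) := fun a => by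
    have := hN.smul_mem a _ he
    simpa [mul_comm a e] using this
  refine ⟨e, fun a b => ⟨fun hab => ?_, ?_⟩⟩
  · exact (Band.existsUnique_neg a).unique hab (h a)
  · rintro rfl
    exact h a

/-- The localization `S⁻¹B` as a band. -/
instance localizationBand (S : Submonoid B) : Band (Localization S) where
  null := locNull S
  null_isPlusIdeal := plusIdealSpan_isPlusIdeal _
  existsUnique_neg x := by
    obtain ⟨e, he⟩ := exists_neg_one (B := B)
    refine ⟨locMap S e * x, ?_, ?_⟩
    · have h1 : ({1, e} : Multiset B) ∈ Band.null (B := B) := (he 1 e).2 (mul_one e).symm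
      have h2 := (plusIdealSpan_isPlusIdeal _).smul_mem x _
        (subset_plusIdealSpan {t | ∃ s ∈ Band.null (B := B), t = s.map (locMap S)} ⟨_, h1, rfl⟩)
      simpa [mul_comm x, locNull] using h2
    · intro y hy
      classical
      obtain ⟨s, hs, n, hn, h⟩ := exists_of_mem_locNull S _ hy
      have h' : n.map (locMap S) = locMap S s * x ::ₘ {locMap S s * y} := by simpa using h
      obtain ⟨p, hp, hpx, hr⟩ := (Multiset.map_eq_cons _ _ _ _).2 h'
      obtain ⟨n', rfl⟩ := Multiset.exists_cons_of_mem hp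
      rw [Multiset.erase_cons_head] at hr
      obtain ⟨q, rfl, hq⟩ := Multiset.map_eq_singleton.1 hr
      have hqp : q = e * p := (he p q).1 hn
      rw [hqp, map_mul, hpx] at hq
      refine (locMap_isUnit S ⟨s, hs⟩).mul_left_cancel ?_
      rw [← hq]
      ac_rfl

/-- The localization map `B → S⁻¹B` as a band morphism. -/
def locHom (S : Submonoid B) : BandHom B (Localization S) where
  toHom := locMap S
  map_null s hs := subset_plusIdealSpan _ ⟨s, hs, rfl⟩

end Localization

/-! ### `m`-ideals -/

/-- An `m`-ideal: `0 ∈ I` and `B · I = I`. -/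
structure IsMIdeal {B : Type u} [Band B] (I : Set B) : Prop where
  zero_mem : (0 : B) ∈ I
  mul_mem : ∀ b : B, ∀ a ∈ I, b * a ∈ I

/-- A prime `m`-ideal: an `m`-ideal whose complement is a multiplicative subset. -/
structure IsPrimeMIdeal {B : Type u} [Band B] (p : Set B) : Prop where
  isMIdeal : IsMIdeal p
  one_notMem : (1 : B) ∉ p
  mul_notMem : ∀ a b : B, a ∉ p → b ∉ p → a * b ∉ p

/-! ### Affine band schemes and topologies on them -/

/-- The category of affine band schemes: the opposite category of bands. -/
abbrev BAff : Type (u + 1) := BandCat.{u}ᵒᵖ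

/-- The affine band scheme of a band. -/
abbrev Spec (B : BandCat.{u}) : BAff.{u} := op B

/-- The band `B[h⁻¹]`. -/
abbrev finLoc (B : BandCat.{u}) (h : B.carrier) : BandCat.{u} :=
  ⟨Localization (Submonoid.powers h)⟩

/-- The morphism `ι_h^* : U_h = Spec B[h⁻¹] ⟶ Spec B` induced by the localization map. -/
def principal (B : BandCat.{u}) (h : B.carrier) : Spec (finLoc B h) ⟶ Spec B :=
  Quiver.Hom.op (show B ⟶ finLoc B h from locHom (Submonoid.powers h))

section Topology

/- `F` realizes affine band schemes as topological spaces: `F.obj X` is the underlying space of `X`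
and `F.map φ` is the continuous map underlying a morphism `φ`. -/
variable (F : BAff.{u} ⥤ TopCat.{u})

/-- `φ : U ⟶ X` is an open immersion, that is, it identifies `U` with an affine open subscheme of
`X`: the map of spaces is an open embedding, and every morphism into `X` whose image is contained
in that of `U` factors uniquely through `U`. -/
structure IsOpenImmersion {U X : BAff.{u}} (φ : U ⟶ X) : Prop where
  isOpenEmbedding : Topology.IsOpenEmbedding (F.map φ)
  existsUnique_lift : ∀ (Y : BAff.{u}) (ψ : Y ⟶ X),
    Set.range (F.map ψ) ⊆ Set.range (F.map φ) → ∃! χ : Y ⟶ U, χ ≫ φ = ψ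

/-- Topological covering families of affine band schemes: families of open immersions into `X` whose
images cover the underlying space of `X`. -/
structure IsCoveringFamily {X : BAff.{u}} {I : Type u} {U : I → BAff.{u}}
    (φ : ∀ i, U i ⟶ X) : Prop where
  isOpenImmersion : ∀ i, IsOpenImmersion F (φ i)
  exists_mem_range : ∀ x : F.obj X, ∃ i, x ∈ Set.range (F.map (φ i))

/-- The underlying subset of the principal open subscheme `U_h` of `Spec B`. -/
def principalOpen (B : BandCat.{u}) (h : B.carrier) : Set (F.obj (Spec B)) :=
  Set.range (F.map (principal B h))

/-- The topology is generated by principal opens. -/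
structure AxiomA1 : Prop where
  isOpenImmersion_principal : ∀ (B : BandCat.{u}) (h : B.carrier),
    IsOpenImmersion F (principal B h)
  isTopologicalBasis : ∀ B : BandCat.{u},
    TopologicalSpace.IsTopologicalBasis (Set.range (principalOpen F B))
  exists_covering : ∀ (B : BandCat.{u}) (V : BAff.{u}) (φ : V ⟶ Spec B), IsOpenImmersion F φ →
    ∃ (I : Type u) (h : I → B.carrier) (χ : ∀ i, Spec (finLoc B (h i)) ⟶ V),
      (∀ i, χ i ≫ φ = principal B (h i)) ∧ IsCoveringFamily F χ

/-- The topology is functorial: covering families are stable under base change (continuity of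
morphisms is part of the functor `F`). -/
def AxiomA2 : Prop :=
  ∀ (X X' : BAff.{u}) (ψ : X' ⟶ X) (I : Type u) (U U' : I → BAff.{u}) (φ : ∀ i, U i ⟶ X)
    (φ' : ∀ i, U' i ⟶ X') (ψ' : ∀ i, U' i ⟶ U i), IsCoveringFamily F φ →
    (∀ i, IsPullback (ψ' i) (φ' i) (φ i) ψ) → IsCoveringFamily F φ'

/-- Every affine band scheme `Y` defines a sheaf `Hom(-, Y)`: for every covering family `Uᵢ ⟶ X`,
morphisms `X ⟶ Y` correspond to families of morphisms `Uᵢ ⟶ Y` that agree on overlaps. -/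
def AxiomA3 : Prop :=
  ∀ (X : BAff.{u}) (I : Type u) (U : I → BAff.{u}) (φ : ∀ i, U i ⟶ X), IsCoveringFamily F φ →
    ∀ Y : BAff.{u}, (Presieve.ofArrows U φ).IsSheafFor (yoneda.obj Y)

/-- Every affine band scheme is sober: every irreducible closed subset is the closure of a unique
point. -/
def AxiomA4 : Prop :=
  ∀ (X : BAff.{u}) (Z : Set (F.obj X)), IsIrreducible Z → IsClosed Z →
    ∃! z : F.obj X, closure {z} = Z

/-- The spectrum of the trivial band is empty. -/
def TrivialSpecEmpty : Prop :=
  ∀ B : BandCat.{u}, Subsingleton B.carrier → IsEmpty (F.obj (Spec B))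

/-- The set `S_x` of all `h` in `B` with `x ∈ U_h`. -/
def stalkSet (B : BandCat.{u}) (x : F.obj (Spec B)) : Set B.carrier :=
  {h | x ∈ principalOpen F B h}

/-- The map `Φ_X` for `X = Spec B`: the inverse image in `B` of the set of nonunits of
`B_x = S_x⁻¹B` under the localization map. (The localization is taken at the submonoid generated by
`S_x`; it is part of the main result that this is `S_x` itself.) -/
def pointIdeal (B : BandCat.{u}) (x : F.obj (Spec B)) : Set B.carrier :=
  {b | ¬ IsUnit (locMap (Submonoid.closure (stalkSet F B x)) b)}

end Topology

end Bands

/-! The crux is that if the `U_{h_i}` cover `Spec B`, then some `h_i` is a unit, apart from the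
empty family over the trivial band (`exists_isUnit_of_isCoveringFamily`). Let `C` be the band `glued
h` of pairs in `B × B` that either lie on the diagonal or have both entries in the `m`-ideal
generated by the `h_i`. The diagonal `B → C` pulls the covering back to a covering of `Spec C`.
Since `h_i · (B × B) ⊆ C`, the inclusion `C → B × B` becomes invertible after inverting `h_i`, so
there are compatible maps `B × B → C[h_i⁻¹]`. The sheaf axiom glues them to `t : B × B → C`, and
separatedness over `Spec B` shows that `t` followed by the two projections `C → B` gives the
projections of `B × B`. Hence `t (1, 0)` has entries `1` and `0`, so `(1, 0)` lies in `C`: either `1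
= 0` or some `h_i` divides `1`.

An affine open `V` is covered by sets `U_{h_i}` that are also principal in `V`; one of them is
therefore all of `V`, or `V` is the spectrum of the trivial band and equals `U_0`.

For points, `pointIdeal` at `x` is the set of `b` with `x ∉ U_b`. Points are separated by the basis
of principal opens, whence injectivity. For surjectivity, the complement of `⋃_{h ∈ p} U_h` is
irreducible, and its generic point has ideal `p`; here the crux shows that `U_g` cannot be covered
by the `U_h`, `h ∈ p`, when `g ∉ p`. -/

namespace Bands

/-! ### The universal property of localizations -/

section Lift

variable {B C : Type u} [Band B] [Band C]

/-- The band morphism `S⁻¹B → C` induced by a band morphism `B → C` that inverts `S`. -/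
noncomputable def locLift (S : Submonoid B) (f : BandHom B C)
    (hf : ∀ s : S, IsUnit (f.toHom s)) : BandHom (Localization S) C where
  toHom :=
    { (Localization.monoidOf S).lift (g := (f.toHom : B →* C)) hf with
      map_zero' := by
        have h := (Localization.monoidOf S).lift_eq (g := (f.toHom : B →* C)) hf 0
        have h0 : Localization.monoidOf S 0 = 0 := map_zero (locMap S)
        rw [h0] at h
        simpa using h }
  map_null := by
    have hN := Band.null_isPlusIdeal (B := C)
    intro s hs
    -- The null set of `S⁻¹B` is the smallest ideal containing the images of null sums, so it
    -- suffices that the sums with null image in `C` form such an ideal.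
    refine hs {s | s.map ((Localization.monoidOf S).lift (g := (f.toHom : B →* C)) hf) ∈
      Band.null (B := C)} ⟨fun s => ?_, ?_, fun s hs t ht => ?_, fun b s hs => ?_⟩ ?_
    · have h := (Localization.monoidOf S).lift_eq (g := (f.toHom : B →* C)) hf 0
      have h0 : Localization.monoidOf S 0 = 0 := map_zero (locMap S)
      rw [h0] at h
      simp only [Set.mem_ofPred_eq, Multiset.map_cons, h]
      simpa using hN.zero_cons_mem_iff _
    · simpa using hN.zero_mem
    · simpa using hN.add_mem _ hs _ ht
    · have h := hN.smul_mem ((Localization.monoidOf S).lift (g := (f.toHom : B →* C)) hf b) _ hs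
      simpa [Multiset.map_map, Function.comp_def] using h
    · rintro _ ⟨n, hn, rfl⟩
      have h := f.map_null n hn
      simp only [Set.mem_ofPred_eq, Multiset.map_map, Function.comp_def]
      convert h using 2
      exact (Localization.monoidOf S).lift_eq (g := (f.toHom : B →* C)) hf _

theorem locLift_locMap (S : Submonoid B) (f : BandHom B C)
    (hf : ∀ s : S, IsUnit (f.toHom s)) (b : B) :
    (locLift S f hf).toHom (locMap S b) = f.toHom b :=
  (Localization.monoidOf S).lift_eq (g := (f.toHom : B →* C)) hf b

theorem isUnit_locMap_iff (S : Submonoid B) (b : B) :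
    IsUnit (locMap S b) ↔ ∃ s ∈ S, b ∣ s := by
  constructor
  · intro h
    obtain ⟨y, hy⟩ := h.exists_right_inv
    induction y using Localization.induction_on with
    | H y =>
      obtain ⟨c, s⟩ := y
      have h1 : Localization.mk b (1 : S) * Localization.mk c s = Localization.mk 1 1 := by
        rw [Localization.mk_one]; exact hy
      rw [Localization.mk_mul, Localization.mk_eq_mk_iff, Localization.r_iff_exists] at h1
      obtain ⟨t, ht⟩ := h1
      refine ⟨t * s, (t * s).2, t * c, ?_⟩
      simp only [one_mul, mul_one, OneMemClass.coe_one] at ht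
      calc (t * s : B) = t * (b * c) := ht.symm
        _ = b * (t * c) := mul_left_comm _ _ _
  · rintro ⟨s, hs, hbs⟩
    exact isUnit_of_dvd_unit (map_dvd (locMap S) hbs) (locMap_isUnit S ⟨s, hs⟩)

end Lift

/-- The band morphism `B → A` corresponding to a morphism `Spec A ⟶ Spec B`. -/
def comap {Y : BAff.{u}} {B : BandCat.{u}} (ψ : Y ⟶ Spec B) :
    BandHom B.carrier Y.unop.carrier := ψ.unop

theorem comap_comp {Y Z : BAff.{u}} {B : BandCat.{u}} (χ : Z ⟶ Y) (ψ : Y ⟶ Spec B)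
    (b : B.carrier) :
    (comap (χ ≫ ψ)).toHom b = (comap (B := Y.unop) χ).toHom ((comap ψ).toHom b) := rfl

theorem hom_ext {Y : BAff.{u}} {B : BandCat.{u}} {φ ψ : Y ⟶ Spec B}
    (h : ∀ b, (comap φ).toHom b = (comap ψ).toHom b) : φ = ψ :=
  Quiver.Hom.unop_inj (BandHom.ext (MonoidWithZeroHom.ext h))

/-- A morphism into `Spec B` factors through `U_h` if and only if it inverts `h`. -/
theorem exists_lift_principal_iff {Y : BAff.{u}} {B : BandCat.{u}} (h : B.carrier)
    (ψ : Y ⟶ Spec B) :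
    (∃ χ : Y ⟶ Spec (finLoc B h), χ ≫ principal B h = ψ) ↔ IsUnit ((comap ψ).toHom h) := by
  constructor
  · rintro ⟨χ, rfl⟩
    rw [comap_comp]
    exact (locMap_isUnit (Submonoid.powers h) ⟨h, Submonoid.mem_powers h⟩).map
      (comap (B := finLoc B h) χ).toHom
  · intro hu
    refine ⟨Quiver.Hom.op (show finLoc B h ⟶ Y.unop from
      locLift (Submonoid.powers h) (comap ψ) ?_), ?_⟩
    · rintro ⟨_, n, rfl⟩
      simpa using hu.pow n
    · exact hom_ext fun b => locLift_locMap _ (comap ψ) _ b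

/-! ### Principal opens: containment and inverse images. -/

section Topology

variable {F : BAff.{u} ⥤ TopCat.{u}}

theorem IsOpenImmersion.mono {U X : BAff.{u}} {φ : U ⟶ X} (hφ : IsOpenImmersion F φ) :
    Mono φ where
  right_cancellation g k hgk := by
    refine (hφ.existsUnique_lift _ (k ≫ φ) ?_).unique hgk rfl
    rw [F.map_comp]
    rintro _ ⟨y, rfl⟩
    exact ⟨F.map k y, rfl⟩

theorem range_map_comp_subset {X Y Z : BAff.{u}} (χ : Z ⟶ Y) (ψ : Y ⟶ X) :
    Set.range (F.map (χ ≫ ψ)) ⊆ Set.range (F.map ψ) := by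
  rw [F.map_comp]
  rintro _ ⟨y, rfl⟩
  exact ⟨F.map χ y, rfl⟩

/-- Turns topological containment into invertibility; all later algebra enters through this
equivalence. -/
theorem AxiomA1.range_subset_principalOpen_iff (hA1 : AxiomA1 F) {Y : BAff.{u}} {B : BandCat.{u}}
    (h : B.carrier) (ψ : Y ⟶ Spec B) :
    Set.range (F.map ψ) ⊆ principalOpen F B h ↔ IsUnit ((comap ψ).toHom h) := by
  rw [← exists_lift_principal_iff]
  constructor
  · intro hψ
    exact ((hA1.isOpenImmersion_principal B h).existsUnique_lift Y ψ hψ).exists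
  · rintro ⟨χ, rfl⟩
    exact range_map_comp_subset χ _

theorem AxiomA1.isOpen_principalOpen (hA1 : AxiomA1 F) (B : BandCat.{u}) (h : B.carrier) :
    IsOpen (principalOpen F B h) :=
  (hA1.isOpenImmersion_principal B h).isOpenEmbedding.isOpen_range

theorem AxiomA1.exists_principalOpen_subset (hA1 : AxiomA1 F) {B : BandCat.{u}}
    {x : F.obj (Spec B)} {O : Set (F.obj (Spec B))} (hx : x ∈ O) (hO : IsOpen O) :
    ∃ g, x ∈ principalOpen F B g ∧ principalOpen F B g ⊆ O := by
  obtain ⟨_, ⟨g, rfl⟩, h1, h2⟩ := (hA1.isTopologicalBasis B).exists_subset_of_mem_open hx hO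
  exact ⟨g, h1, h2⟩

/-- The inverse image of a principal open is principal open. -/
theorem AxiomA1.map_mem_principalOpen_iff (hA1 : AxiomA1 F) {Y : BAff.{u}} {B : BandCat.{u}}
    (ψ : Y ⟶ Spec B) (h : B.carrier) (y : F.obj Y) :
    F.map ψ y ∈ principalOpen F B h ↔ y ∈ principalOpen F Y.unop ((comap ψ).toHom h) := by
  constructor
  · intro hy
    -- Near `y` shrink to a principal `U_a` inside the inverse image; the pullback of `h` is a unit
    -- on `U_a`, so `U_a` lies in the principal open it defines.
    obtain ⟨a, hya, ha⟩ := hA1.exists_principalOpen_subset (B := Y.unop) (x := y)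
      (O := F.map ψ ⁻¹' principalOpen F B h) hy
      ((hA1.isOpen_principalOpen B h).preimage (F.map ψ).hom.continuous)
    have hu : Set.range (F.map (principal Y.unop a ≫ ψ)) ⊆ principalOpen F B h := by
      rw [F.map_comp]
      rintro _ ⟨z, rfl⟩
      exact ha ⟨z, rfl⟩
    rw [hA1.range_subset_principalOpen_iff, comap_comp,
      ← hA1.range_subset_principalOpen_iff (F := F) _ (principal Y.unop a)] at hu
    exact hu hya
  · rintro ⟨z, rfl⟩
    have hu : IsUnit ((comap (principal Y.unop ((comap ψ).toHom h) ≫ ψ)).toHom h) := by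
      rw [comap_comp, ← exists_lift_principal_iff]
      exact ⟨𝟙 _, Category.id_comp _⟩
    have := (hA1.range_subset_principalOpen_iff (F := F) _ _).2 hu ⟨z, rfl⟩
    rwa [F.map_comp] at this

theorem AxiomA1.isCoveringFamily_principal_comap (hA1 : AxiomA1 F) {Y : BAff.{u}}
    {B : BandCat.{u}} (ψ : Y ⟶ Spec B) {I : Type u} {h : I → B.carrier}
    (hh : IsCoveringFamily F fun i => principal B (h i)) :
    IsCoveringFamily F fun i => principal Y.unop ((comap ψ).toHom (h i)) where
  isOpenImmersion _ := hA1.isOpenImmersion_principal _ _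
  exists_mem_range y :=
    (hh.exists_mem_range (F.map ψ y)).imp fun _ hi => (hA1.map_mem_principalOpen_iff ψ _ y).1 hi

theorem AxiomA1.isIso_principal (hA1 : AxiomA1 F) {B : BandCat.{u}} {h : B.carrier}
    (hh : IsUnit h) : IsIso (principal B h) := by
  have := (hA1.isOpenImmersion_principal B h).mono
  obtain ⟨χ, hχ⟩ := (exists_lift_principal_iff h (𝟙 (Spec B))).2 hh
  have : IsSplitEpi (principal B h) := ⟨⟨χ, hχ⟩⟩
  exact isIso_of_mono_of_isSplitEpi _

end Topology

/-! ### Two copies of a band, glued along an `m`-ideal -/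

section Double

variable {B : Type u} [Band B]

theorem IsPlusIdeal.preimage {M N : Type u} [CommMonoidWithZero M] [CommMonoidWithZero N]
    (f : M →*₀ N) {I : Set (Multiset N)} (hI : IsPlusIdeal I) :
    IsPlusIdeal {s : Multiset M | s.map f ∈ I} where
  zero_cons_mem_iff s := by
    simpa using hI.zero_cons_mem_iff (s.map f)
  zero_mem := by simpa using hI.zero_mem
  add_mem s hs t ht := by simpa using hI.add_mem _ hs _ ht
  smul_mem b s hs := by
    simpa [Multiset.map_map, Function.comp_def] using hI.smul_mem (f b) _ hs

theorem IsPlusIdeal.inter {M : Type u} [CommMonoidWithZero M] {I J : Set (Multiset M)}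
    (hI : IsPlusIdeal I) (hJ : IsPlusIdeal J) : IsPlusIdeal (I ∩ J) where
  zero_cons_mem_iff s := and_congr (hI.zero_cons_mem_iff s) (hJ.zero_cons_mem_iff s)
  zero_mem := ⟨hI.zero_mem, hJ.zero_mem⟩
  add_mem s hs t ht := ⟨hI.add_mem s hs.1 t ht.1, hJ.add_mem s hs.2 t ht.2⟩
  smul_mem b s hs := ⟨hI.smul_mem b s hs.1, hJ.smul_mem b s hs.2⟩

/-- The band structure on a submonoid with zero of `B × B` that contains the diagonal. -/
abbrev bandOfPair {M : Type u} [CommMonoidWithZero M] (f g : M →*₀ B)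
    (hfg : ∀ x y, f x = f y → g x = g y → x = y) (d : B → M) (hf : ∀ b, f (d b) = b)
    (hg : ∀ b, g (d b) = b) : Band M where
  null := {s | s.map f ∈ Band.null (B := B)} ∩ {s | s.map g ∈ Band.null (B := B)}
  null_isPlusIdeal :=
    (Band.null_isPlusIdeal.preimage f).inter (Band.null_isPlusIdeal.preimage g)
  existsUnique_neg a := by
    obtain ⟨e, he⟩ := exists_neg_one (B := B)
    -- The diagonal element `d e`, with `e` the additive inverse of `1` in `B`, acts as `-1` in both
    -- coordinates.
    refine ⟨d e * a, ⟨?_, ?_⟩, fun b hb => hfg _ _ ?_ ?_⟩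
    · have := (he (f a) (e * f a)).2 rfl
      simpa [hf] using this
    · have := (he (g a) (e * g a)).2 rfl
      simpa [hg] using this
    · have := (he (f a) (f b)).1 (by simpa using hb.1)
      simpa [hf] using this
    · have := (he (g a) (g b)).1 (by simpa using hb.2)
      simpa [hg] using this

/-- The first projection of pointed monoids. -/
def fstHom (B : Type u) [Band B] : B × B →*₀ B where
  toFun := Prod.fst
  map_zero' := rfl
  map_one' := rfl
  map_mul' _ _ := rfl

/-- The second projection of pointed monoids. -/
def sndHom (B : Type u) [Band B] : B × B →*₀ B where
  toFun := Prod.snd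
  map_zero' := rfl
  map_one' := rfl
  map_mul' _ _ := rfl

instance prodBand : Band (B × B) :=
  bandOfPair (fstHom B) (sndHom B)
    (fun _ _ => Prod.ext) (fun b => (b, b)) (fun _ => rfl) (fun _ => rfl)

theorem mem_null_prod {s : Multiset (B × B)} : s ∈ Band.null (B := B × B) ↔
    s.map Prod.fst ∈ Band.null (B := B) ∧ s.map Prod.snd ∈ Band.null (B := B) := Iff.rfl

/-- The pairs in `B × B` whose entries agree or are both divisible by members of the family `h`. -/
def glued {I : Type u} (h : I → B) : Submonoid (B × B) where
  carrier := {x | x.1 = x.2 ∨ (∃ i, h i ∣ x.1) ∧ ∃ i, h i ∣ x.2}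
  one_mem' := Or.inl rfl
  mul_mem' := by
    rintro x y (hx | ⟨⟨i, hi⟩, ⟨j, hj⟩⟩) hy
    · rcases hy with hy | ⟨⟨i, hi⟩, ⟨j, hj⟩⟩
      · exact Or.inl (by simp [hx, hy])
      · exact Or.inr ⟨⟨i, hi.mul_left _⟩, ⟨j, hj.mul_left _⟩⟩
    · exact Or.inr ⟨⟨i, hi.mul_right _⟩, ⟨j, hj.mul_right _⟩⟩

variable {I : Type u} (h : I → B)

instance : CommMonoidWithZero (glued h) where
  zero := ⟨0, Or.inl rfl⟩
  zero_mul _ := Subtype.ext (zero_mul _)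
  mul_zero _ := Subtype.ext (mul_zero _)

/-- The inclusion of `glued h` into `B × B`. -/
def gluedSubtype : glued h →*₀ B × B where
  toFun := Subtype.val
  map_zero' := rfl
  map_one' := rfl
  map_mul' _ _ := rfl

instance gluedBand : Band (glued h) :=
  bandOfPair ((fstHom B).comp (gluedSubtype h))
    ((sndHom B).comp (gluedSubtype h))
    (fun _ _ h₁ h₂ => Subtype.ext (Prod.ext h₁ h₂)) (fun b => ⟨(b, b), Or.inl rfl⟩)
    (fun _ => rfl) (fun _ => rfl)

theorem mem_null_glued {s : Multiset (glued h)} : s ∈ Band.null (B := glued h) ↔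
    s.map (fun x => x.1.1) ∈ Band.null (B := B) ∧ s.map (fun x => x.1.2) ∈ Band.null (B := B) :=
  Iff.rfl

/-- The diagonal map. -/
def gluedDiag : BandHom B (glued h) where
  toHom :=
    { toFun := fun b => ⟨(b, b), Or.inl rfl⟩
      map_zero' := rfl
      map_one' := rfl
      map_mul' := fun _ _ => rfl }
  map_null s hs := by
    rw [mem_null_glued, Multiset.map_map, Multiset.map_map]
    simpa using hs

/-- The first projection of `B × B`. -/
def prodFst : BandHom (B × B) B where
  toHom := fstHom B
  map_null _ hs := hs.1

/-- The second projection of `B × B`. -/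
def prodSnd : BandHom (B × B) B where
  toHom := sndHom B
  map_null _ hs := hs.2

/-- The first projection of `glued h`. -/
def gluedFst : BandHom (glued h) B where
  toHom := (fstHom B).comp (gluedSubtype h)
  map_null _ hs := hs.1

/-- The second projection of `glued h`. -/
def gluedSnd : BandHom (glued h) B where
  toHom := (sndHom B).comp (gluedSubtype h)
  map_null _ hs := hs.2

/-- Multiplication by `h i` as a map `B × B → glued h`. -/
def mulGlued (i : I) (x : B × B) : glued h :=
  ⟨(h i * x.1, h i * x.2), Or.inr ⟨⟨i, dvd_mul_right _ _⟩, ⟨i, dvd_mul_right _ _⟩⟩⟩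

/-- The case `i = j` says that `x ↦ (h i • x) / h i` is multiplicative. -/
theorem mulGlued_mul (i j : I) (x y : B × B) :
    mulGlued h i x * mulGlued h j y =
      (gluedDiag h).toHom (h i) * mulGlued h j (x * y) :=
  Subtype.ext (Prod.ext (by simp [mulGlued, gluedDiag]; ac_rfl)
    (by simp [mulGlued, gluedDiag]; ac_rfl))

/-- The localization of `glued h` at a member of the family `h`. -/
abbrev gluedLoc (i : I) : Type u := Localization (Submonoid.powers ((gluedDiag h).toHom (h i)))

/-- The band morphism `B × B → (glued h)[(h i)⁻¹]` that sends `x` to `(h i • x) / h i`. -/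
def toGluedLoc (i : I) : BandHom (B × B) (gluedLoc h i) where
  toHom :=
    { toFun := fun x => Localization.mk (mulGlued h i x) ⟨_, Submonoid.mem_powers _⟩
      map_zero' := by
        have : mulGlued h i 0 = 0 := Subtype.ext (Prod.ext (mul_zero _) (mul_zero _))
        rw [this]
        exact Localization.mk_zero _
      map_one' := by
        have : mulGlued h i 1 = (gluedDiag h).toHom (h i) :=
          Subtype.ext (Prod.ext (mul_one _) (mul_one _))
        rw [this]
        exact Localization.mk_self (⟨_, Submonoid.mem_powers _⟩ : Submonoid.powers _)
      map_mul' := fun x y => by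
        rw [Localization.mk_mul, mulGlued_mul, Localization.mk_eq_mk_iff,
          Localization.r_iff_exists]
        exact ⟨1, by simp [mul_assoc]⟩ }
  map_null s hs := by
    have hI := Band.null_isPlusIdeal (B := B)
    have h1 : s.map (mulGlued h i) ∈ Band.null (B := glued h) := by
      rw [mem_null_glued, Multiset.map_map, Multiset.map_map]
      have h2 := hI.smul_mem (h i) _ (mem_null_prod.1 hs).1
      have h3 := hI.smul_mem (h i) _ (mem_null_prod.1 hs).2
      rw [Multiset.map_map] at h2 h3
      exact ⟨h2, h3⟩
    -- Null sums remain null after multiplication by `1 / h i`.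
    have h4 := (Band.null_isPlusIdeal (B := gluedLoc h i)).smul_mem
      (Localization.mk 1 ⟨_, Submonoid.mem_powers _⟩) _ ((locHom _).map_null _ h1)
    rw [Multiset.map_map, Multiset.map_map] at h4
    convert h4 using 2
    change Localization.mk _ _ = Localization.mk _ _ * Localization.mk _ _
    rw [Localization.mk_mul, one_mul, mul_one]

theorem locMap_mul_toGluedLoc (i : I) (x : B × B) :
    locMap (Submonoid.powers ((gluedDiag h).toHom (h i))) ((gluedDiag h).toHom (h i)) * (toGluedLoc h i).toHom x =
      locMap (Submonoid.powers ((gluedDiag h).toHom (h i))) (mulGlued h i x) := by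
  change Localization.mk _ _ * Localization.mk _ _ = Localization.mk _ _
  rw [Localization.mk_mul, Localization.mk_eq_mk_iff, Localization.r_iff_exists]
  exact ⟨1, by simp⟩

/-- After multiplication by the unit `h i * h j`, both sides become images of the single element `h
i • h j • x` of `glued h`, where `u` and `v` agree. -/
theorem toGluedLoc_compatible (i j : I) {E : Type u} [Band E] (u : BandHom (gluedLoc h i) E)
    (v : BandHom (gluedLoc h j) E)
    (huv : ∀ c : glued h, u.toHom (locMap _ c) = v.toHom (locMap _ c)) (x : B × B) :
    u.toHom ((toGluedLoc h i).toHom x) = v.toHom ((toGluedLoc h j).toHom x) := by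
  have hi : IsUnit (u.toHom (locMap (Submonoid.powers ((gluedDiag h).toHom (h i)))
      ((gluedDiag h).toHom (h i)))) :=
    (locMap_isUnit _ ⟨_, Submonoid.mem_powers _⟩).map u.toHom
  have hj : IsUnit (v.toHom (locMap (Submonoid.powers ((gluedDiag h).toHom (h j)))
      ((gluedDiag h).toHom (h j)))) :=
    (locMap_isUnit _ ⟨_, Submonoid.mem_powers _⟩).map v.toHom
  have h1 := congrArg u.toHom (locMap_mul_toGluedLoc h i x)
  have h2 := congrArg v.toHom (locMap_mul_toGluedLoc h j x)
  rw [map_mul] at h1 h2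
  have h3 : (gluedDiag h).toHom (h j) * mulGlued h i x =
      (gluedDiag h).toHom (h i) * mulGlued h j x :=
    Subtype.ext (Prod.ext (mul_left_comm _ _ _) (mul_left_comm _ _ _))
  have h4 := congrArg (fun c => u.toHom (locMap _ c)) h3
  simp only [map_mul] at h4
  refine (hi.mul hj).mul_left_cancel ?_
  rw [mul_assoc, mul_assoc, h2, mul_left_comm, h1, ← huv, ← huv, h4]

end Double

/-! ### Covering families -/

section Topology

variable {F : BAff.{u} ⥤ TopCat.{u}}

/-- The sheaf condition in terms of bands; overlaps are tested on all bands `E` receiving both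
localizations compatibly over `C`. -/
theorem AxiomA3.exists_amalgamation (hA3 : AxiomA3 F) {C D : BandCat.{u}} {I : Type u}
    {k : I → C.carrier} (hk : IsCoveringFamily F fun i => principal C (k i))
    (s : ∀ i, BandHom D.carrier (Localization (Submonoid.powers (k i))))
    (hs : ∀ (i j : I) (E : BandCat.{u})
      (u : BandHom (Localization (Submonoid.powers (k i))) E.carrier)
      (v : BandHom (Localization (Submonoid.powers (k j))) E.carrier),
      (∀ c, u.toHom (locMap _ c) = v.toHom (locMap _ c)) →
        ∀ x, u.toHom ((s i).toHom x) = v.toHom ((s j).toHom x)) :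
    ∃ t : BandHom D.carrier C.carrier, ∀ i x, locMap _ (t.toHom x) = (s i).toHom x := by
  obtain ⟨t, ht, -⟩ := (Presieve.isSheafFor_arrows_iff _ _).1 (hA3 _ _ _ _ hk (Spec D))
    (fun i => Quiver.Hom.op (show D ⟶ finLoc C (k i) from s i))
    (fun i j Z u v huv => hom_ext (Y := Z) (B := D) (hs i j Z.unop
      (comap (B := finLoc C (k i)) u) (comap (B := finLoc C (k j)) v) fun c =>
        congrArg (fun w => (comap (B := C) w).toHom c) huv))
  exact ⟨comap t, fun i x => congrArg (fun w => (comap (B := D) w).toHom x) (ht i)⟩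

theorem AxiomA3.hom_ext_of_locMap (hA3 : AxiomA3 F) {C D : BandCat.{u}} {I : Type u}
    {k : I → C.carrier} (hk : IsCoveringFamily F fun i => principal C (k i))
    {t t' : BandHom D.carrier C.carrier}
    (htt' : ∀ i x, locMap (Submonoid.powers (k i)) (t.toHom x) = locMap _ (t'.toHom x)) :
    t = t' := by
  have h := (hA3 _ _ _ _ hk (Spec D)).isSeparatedFor.ext
    (t₁ := Quiver.Hom.op (show D ⟶ C from t)) (t₂ := Quiver.Hom.op (show D ⟶ C from t')) ?_
  · exact congrArg Quiver.Hom.unop h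
  · rintro _ _ ⟨i⟩
    exact hom_ext (B := D) (htt' i)

/-- A covering family of `Spec B` by principal opens contains `Spec B` itself, unless it is the
empty family over the spectrum of the trivial band. -/
theorem exists_isUnit_of_isCoveringFamily (hA1 : AxiomA1 F) (hA3 : AxiomA3 F) {B : BandCat.{u}}
    {I : Type u} {h : I → B.carrier} (hh : IsCoveringFamily F fun i => principal B (h i)) :
    (∃ i, IsUnit (h i)) ∨ IsEmpty I ∧ Subsingleton B.carrier := by
  let C : BandCat.{u} := ⟨glued h⟩
  let D : BandCat.{u} := ⟨B.carrier × B.carrier⟩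
  have hC := hA1.isCoveringFamily_principal_comap
    (Quiver.Hom.op (show B ⟶ C from gluedDiag h)) hh
  obtain ⟨t, ht⟩ := hA3.exists_amalgamation (C := C) (D := D) hC (toGluedLoc h)
    (fun i j E u v huv x => toGluedLoc_compatible h i j u v huv x)
  -- In each coordinate, `t x` and `x` agree up to a power of `h i`, hence have equal images in
  -- `B[(h i)⁻¹]`.
  have ht' : ∀ i x, ∃ n : ℕ, (h i ^ n * (h i * (t.toHom x).1.1) = h i ^ n * (h i * x.1)) ∧
      (h i ^ n * (h i * (t.toHom x).1.2) = h i ^ n * (h i * x.2)) := by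
    intro i x
    have h1 : (Localization.mk (t.toHom x) 1 : gluedLoc h i) =
      Localization.mk (mulGlued h i x) ⟨_, Submonoid.mem_powers _⟩ := ht i x
    rw [Localization.mk_eq_mk_iff, Localization.r_iff_exists] at h1
    obtain ⟨⟨_, n, rfl⟩, hn⟩ := h1
    refine ⟨n, ?_, ?_⟩
    · have := congrArg (gluedFst h).toHom hn
      simp only [map_mul, map_pow, OneMemClass.coe_one, one_mul] at this
      exact this
    · have := congrArg (gluedSnd h).toHom hn
      simp only [map_mul, map_pow, OneMemClass.coe_one, one_mul] at this
      exact this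
  have aux : ∀ i (a b : B.carrier) (n : ℕ), h i ^ n * (h i * a) = h i ^ n * (h i * b) →
      locMap (Submonoid.powers (h i)) a = locMap _ b := fun i a b n hab => by
    refine ((Localization.monoidOf (Submonoid.powers (h i))).eq_iff_exists).2
      ⟨⟨h i ^ (n + 1), n + 1, rfl⟩, ?_⟩
    simpa [pow_succ, mul_assoc] using hab
  have hfst := hA3.hom_ext_of_locMap (C := B) (D := D) hh
    (t := show D ⟶ B from (show D ⟶ C from t) ≫ (show C ⟶ B from gluedFst h))
    (t' := prodFst) fun i x => by
      obtain ⟨n, hn, -⟩ := ht' i x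
      exact aux _ _ _ n hn
  have hsnd := hA3.hom_ext_of_locMap (C := B) (D := D) hh
    (t := show D ⟶ B from (show D ⟶ C from t) ≫ (show C ⟶ B from gluedSnd h))
    (t' := prodSnd) fun i x => by
      obtain ⟨n, -, hn⟩ := ht' i x
      exact aux _ _ _ n hn
  have h1 : (t.toHom ((1, 0) : B.carrier × B.carrier)).1.1 = 1 :=
    congrArg (fun f : BandHom D.carrier B.carrier => f.toHom ((1, 0) : B.carrier × B.carrier)) hfst
  have h0 : (t.toHom ((1, 0) : B.carrier × B.carrier)).1.2 = 0 :=
    congrArg (fun f : BandHom D.carrier B.carrier => f.toHom ((1, 0) : B.carrier × B.carrier)) hsnd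
  -- Membership in `glued h`: the entries `1` and `0` are either equal or both divisible by members
  -- of the family.
  rcases (t.toHom ((1, 0) : B.carrier × B.carrier)).2 with h2 | ⟨⟨i, hi⟩, -⟩
  · rw [h1, h0] at h2
    have hB : Subsingleton B.carrier := subsingleton_of_zero_eq_one h2.symm
    rcases isEmpty_or_nonempty I with hI | ⟨⟨i⟩⟩
    · exact Or.inr ⟨hI, hB⟩
    · exact Or.inl ⟨i, isUnit_of_subsingleton _⟩
  · rw [h1] at hi
    exact Or.inl ⟨i, isUnit_of_dvd_one hi⟩

/-! ### Affine open subschemes -/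

theorem IsPlusIdeal.mem_of_subsingleton {M : Type u} [CommMonoidWithZero M] [Subsingleton M]
    {I : Set (Multiset M)} (hI : IsPlusIdeal I) (s : Multiset M) : s ∈ I := by
  induction s using Multiset.induction_on with
  | empty => exact hI.zero_mem
  | cons a s ih =>
    rw [Subsingleton.elim a 0]
    exact (hI.zero_cons_mem_iff _).2 ih

theorem subsingleton_finLoc_zero (B : BandCat.{u}) : Subsingleton (finLoc B 0).carrier := by
  refine subsingleton_of_zero_eq_one ?_
  have h0 := locMap_isUnit (Submonoid.powers (0 : B.carrier)) ⟨0, Submonoid.mem_powers _⟩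
  rw [map_zero, isUnit_zero_iff] at h0
  exact h0

theorem exists_hom_of_subsingleton {B : BandCat.{u}} (X : BAff.{u}) [Subsingleton B.carrier] :
    Nonempty (Spec B ⟶ X) :=
  ⟨Quiver.Hom.op (show X.unop ⟶ B from ⟨⟨⟨0, rfl⟩, Subsingleton.elim _ _,
    fun _ _ => Subsingleton.elim _ _⟩, fun _ _ => Band.null_isPlusIdeal.mem_of_subsingleton _⟩)⟩

theorem exists_iso_principal (hA1 : AxiomA1 F) (hA3 : AxiomA3 F) {B : BandCat.{u}} {V : BAff.{u}}
    {φ : V ⟶ Spec B} (hφ : IsOpenImmersion F φ) :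
    ∃ (h : B.carrier) (e : V ≅ Spec (finLoc B h)), e.hom ≫ principal B h = φ := by
  have := hφ.mono
  -- Such data give factorizations of the monomorphisms `φ` and `principal B h` through each other,
  -- hence mutually inverse maps.
  suffices H : ∃ (h : B.carrier) (χ : Spec (finLoc B h) ⟶ V),
      χ ≫ φ = principal B h ∧ IsUnit ((comap φ).toHom h) by
    obtain ⟨h, χ, hχ, hu⟩ := H
    have := (hA1.isOpenImmersion_principal B h).mono
    obtain ⟨σ, hσ⟩ := (exists_lift_principal_iff h φ).2 hu
    refine ⟨h, ⟨σ, χ, ?_, ?_⟩, hσ⟩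
    · rw [← cancel_mono φ, Category.assoc, hχ, hσ, Category.id_comp]
    · rw [← cancel_mono (principal B h), Category.assoc, hσ, hχ, Category.id_comp]
  obtain ⟨I, h, χ, hχ, hcov⟩ := hA1.exists_covering B V φ hφ
  have hV : IsCoveringFamily F fun i => principal V.unop ((comap φ).toHom (h i)) :=
    ⟨fun i => hA1.isOpenImmersion_principal _ _, fun y => by
      obtain ⟨i, z, rfl⟩ := hcov.exists_mem_range y
      refine ⟨i, (hA1.map_mem_principalOpen_iff φ (h i) _).1 ⟨z, ?_⟩⟩
      rw [← hχ, F.map_comp]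
      rfl⟩
  rcases exists_isUnit_of_isCoveringFamily hA1 hA3 hV with ⟨i, hi⟩ | ⟨-, hs⟩
  · exact ⟨h i, χ i, hχ i, hi⟩
  -- Here the band of `V` is trivial, so `h = 0` works: `B[0⁻¹]` is trivial too.
  · have := subsingleton_finLoc_zero B
    obtain ⟨χ⟩ := exists_hom_of_subsingleton (B := finLoc B 0) V
    exact ⟨0, χ, hom_ext fun b => Subsingleton.elim (α := (finLoc B 0).carrier) _ _,
      isUnit_of_subsingleton _⟩

theorem isCoveringFamily_iff (hA1 : AxiomA1 F) (hA3 : AxiomA3 F) {X : BAff.{u}} {I : Type u}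
    {U : I → BAff.{u}} {φ : ∀ i, U i ⟶ X} (hφ : ∀ i, IsOpenImmersion F (φ i)) :
    IsCoveringFamily F φ ↔ (∃ i, IsIso (φ i)) ∨ (IsEmpty I ∧ IsEmpty (F.obj X)) := by
  constructor
  · intro hc
    choose h e he using fun i => exists_iso_principal (B := X.unop) hA1 hA3 (hφ i)
    have hp : IsCoveringFamily F fun i => principal X.unop (h i) :=
      ⟨fun i => hA1.isOpenImmersion_principal _ _, fun x =>
        (hc.exists_mem_range x).imp fun i hi => by
          rw [← he] at hi
          exact range_map_comp_subset _ _ hi⟩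
    rcases exists_isUnit_of_isCoveringFamily hA1 hA3 hp with ⟨i, hi⟩ | ⟨hI, -⟩
    · have := hA1.isIso_principal (F := F) hi
      refine Or.inl ⟨i, ?_⟩
      rw [← he]
      infer_instance
    · exact Or.inr ⟨hI, ⟨fun x => hI.elim (hc.exists_mem_range x).choose⟩⟩
  · rintro (⟨i, hi⟩ | ⟨-, hX⟩)
    · refine ⟨hφ, fun x => ⟨i, F.map (inv (φ i)) x, ?_⟩⟩
      rw [← ConcreteCategory.comp_apply, ← F.map_comp, IsIso.inv_hom_id, F.map_id]
      rfl
    · exact ⟨hφ, fun x => hX.elim x⟩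

end Topology

/-! ### Points and prime `m`-ideals -/

section Topology

variable {F : BAff.{u} ⥤ TopCat.{u}}

theorem AxiomA1.principalOpen_subset_iff (hA1 : AxiomA1 F) {B : BandCat.{u}} (g h : B.carrier) :
    principalOpen F B g ⊆ principalOpen F B h ↔ ∃ n : ℕ, h ∣ g ^ n := by
  have h1 := hA1.range_subset_principalOpen_iff h (principal B g)
  refine h1.trans ((isUnit_locMap_iff (Submonoid.powers g) h).trans ?_)
  constructor
  · rintro ⟨_, ⟨n, rfl⟩, hn⟩
    exact ⟨n, hn⟩
  · rintro ⟨n, hn⟩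
    exact ⟨_, ⟨n, rfl⟩, hn⟩

theorem AxiomA1.principalOpen_one (hA1 : AxiomA1 F) (B : BandCat.{u}) :
    principalOpen F B 1 = Set.univ := by
  refine Set.eq_univ_of_forall fun x => ?_
  obtain ⟨g, hg, -⟩ := hA1.exists_principalOpen_subset (Set.mem_univ x) isOpen_univ
  exact (hA1.principalOpen_subset_iff g 1).2 ⟨0, one_dvd _⟩ hg

theorem AxiomA1.principalOpen_mul (hA1 : AxiomA1 F) {B : BandCat.{u}} (g h : B.carrier) :
    principalOpen F B (g * h) = principalOpen F B g ∩ principalOpen F B h := by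
  refine Set.Subset.antisymm (Set.subset_inter ?_ ?_) fun x hx => ?_
  · exact (hA1.principalOpen_subset_iff _ _).2 ⟨1, by simp⟩
  · exact (hA1.principalOpen_subset_iff _ _).2 ⟨1, by simp⟩
  · obtain ⟨a, hxa, ha⟩ := hA1.exists_principalOpen_subset hx
      ((hA1.isOpen_principalOpen B g).inter (hA1.isOpen_principalOpen B h))
    -- From `g ∣ a ^ m` and `h ∣ a ^ n` follows `g * h ∣ a ^ (m + n)`, so the basic neighbourhood
    -- `U_a` of `x` lies in `U_{gh}`.
    obtain ⟨m, hm⟩ := (hA1.principalOpen_subset_iff _ _).1 (ha.trans Set.inter_subset_left)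
    obtain ⟨n, hn⟩ := (hA1.principalOpen_subset_iff _ _).1 (ha.trans Set.inter_subset_right)
    exact (hA1.principalOpen_subset_iff _ _).2 ⟨m + n, pow_add a m n ▸ mul_dvd_mul hm hn⟩ hxa

theorem AxiomA1.closure_stalkSet (hA1 : AxiomA1 F) (B : BandCat.{u}) (x : F.obj (Spec B)) :
    (Submonoid.closure (stalkSet F B x) : Set B.carrier) = stalkSet F B x := by
  refine Set.Subset.antisymm (fun h hh => ?_) Submonoid.subset_closure
  induction hh using Submonoid.closure_induction with
  | mem h hh => exact hh
  | one =>
    change x ∈ principalOpen F B 1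
    rw [hA1.principalOpen_one]
    trivial
  | mul g h _ _ hg hh =>
    change x ∈ principalOpen F B (g * h)
    rw [hA1.principalOpen_mul]
    exact ⟨hg, hh⟩

/-- An element is a unit in `B_x` exactly when it divides some `s ∈ S_x`; then `U_s ⊆ U_b`, so `b`
itself lies in `S_x`. -/
theorem AxiomA1.mem_pointIdeal_iff (hA1 : AxiomA1 F) {B : BandCat.{u}} {x : F.obj (Spec B)}
    {b : B.carrier} : b ∈ pointIdeal F B x ↔ x ∉ principalOpen F B b := by
  refine not_congr ((isUnit_locMap_iff _ b).trans ?_)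
  simp only [← SetLike.mem_coe, hA1.closure_stalkSet]
  constructor
  · rintro ⟨s, hs, hbs⟩
    exact (hA1.principalOpen_subset_iff s b).2 ⟨1, by simpa using hbs⟩ hs
  · exact fun hx => ⟨b, hx, dvd_rfl⟩

theorem principalOpen_zero (hF : TrivialSpecEmpty F) (B : BandCat.{u}) :
    principalOpen F B 0 = ∅ := by
  have := hF (finLoc B 0) (subsingleton_finLoc_zero B)
  exact Set.range_eq_empty _

theorem AxiomA1.isPrimeMIdeal_pointIdeal (hA1 : AxiomA1 F) (hF : TrivialSpecEmpty F)
    {B : BandCat.{u}} (x : F.obj (Spec B)) : IsPrimeMIdeal (pointIdeal F B x) where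
  isMIdeal :=
    { zero_mem := by simp [hA1.mem_pointIdeal_iff, principalOpen_zero hF]
      mul_mem := fun b a ha => by
        rw [hA1.mem_pointIdeal_iff] at ha ⊢
        rw [hA1.principalOpen_mul]
        exact fun h => ha h.2 }
  one_notMem := by simp [hA1.mem_pointIdeal_iff, hA1.principalOpen_one]
  mul_notMem a b ha hb := by
    rw [hA1.mem_pointIdeal_iff, not_not] at ha hb ⊢
    rw [hA1.principalOpen_mul]
    exact ⟨ha, hb⟩

theorem pointIdeal_injective (hA1 : AxiomA1 F) (hA4 : AxiomA4 F) (B : BandCat.{u}) :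
    Function.Injective (pointIdeal F B) := by
  intro x y hxy
  have hcl : closure {x} = closure {y} := by
    refine inseparable_iff_closure_eq.1 ((hA1.isTopologicalBasis B).inseparable_iff.2 ?_)
    rintro _ ⟨g, rfl⟩
    rw [← not_iff_not, ← hA1.mem_pointIdeal_iff, ← hA1.mem_pointIdeal_iff, hxy]
  exact (hA4 _ _ isIrreducible_singleton.closure isClosed_closure).unique hcl rfl

/-- If `U_g` is covered by the `U_h` with `h` in an `m`-ideal, then some power of `g` lies in it. -/
theorem IsMIdeal.exists_pow_mem (hA1 : AxiomA1 F) (hA3 : AxiomA3 F) {B : BandCat.{u}}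
    {p : Set B.carrier} (hp : IsMIdeal p) {g : B.carrier}
    (hg : ∀ x ∈ principalOpen F B g, ∃ h ∈ p, x ∈ principalOpen F B h) : ∃ n : ℕ, g ^ n ∈ p := by
  have hc : IsCoveringFamily F fun h : p => principal (finLoc B g)
      ((comap (principal B g)).toHom h) :=
    ⟨fun _ => hA1.isOpenImmersion_principal _ _, fun y => by
      obtain ⟨h, hh, hy⟩ := hg (F.map (principal B g) y) ⟨y, rfl⟩
      exact ⟨⟨h, hh⟩, (hA1.map_mem_principalOpen_iff (principal B g) h y).1 hy⟩⟩
  rcases exists_isUnit_of_isCoveringFamily hA1 hA3 hc with ⟨⟨h, hh⟩, hu⟩ | ⟨hI, -⟩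
  · obtain ⟨_, ⟨n, rfl⟩, c, hc⟩ := (isUnit_locMap_iff (Submonoid.powers g) h).1 hu
    refine ⟨n, ?_⟩
    change g ^ n = h * c at hc
    rw [hc, mul_comm]
    exact hp.mul_mem c h hh
  -- The index set `p` contains `0`, which rules out the empty covering.
  · exact hI.elim ⟨0, hp.zero_mem⟩

theorem IsPrimeMIdeal.pow_notMem {B : Type u} [Band B] {p : Set B} (hp : IsPrimeMIdeal p) {g : B}
    (hg : g ∉ p) (n : ℕ) : g ^ n ∉ p := by
  induction n with
  | zero => simpa using hp.one_notMem
  | succ n ih => exact pow_succ g n ▸ hp.mul_notMem _ _ ih hg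

theorem exists_pointIdeal_eq (hA1 : AxiomA1 F) (hA3 : AxiomA3 F) (hA4 : AxiomA4 F)
    {B : BandCat.{u}} {p : Set B.carrier} (hp : IsPrimeMIdeal p) :
    ∃ x, pointIdeal F B x = p := by
  -- The locus where all elements of `p` vanish, whose generic point will be the desired `x`.
  let Z : Set (F.obj (Spec B)) := (⋃ h ∈ p, principalOpen F B h)ᶜ
  have hZ : ∀ g, g ∉ p ↔ (Z ∩ principalOpen F B g).Nonempty := by
    intro g
    constructor
    · intro hg
      by_contra hne
      obtain ⟨n, hn⟩ := hp.isMIdeal.exists_pow_mem (g := g) hA1 hA3 fun x hx => by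
        by_contra hxp
        exact hne ⟨x, by simpa [Z] using hxp, hx⟩
      exact hp.pow_notMem hg n hn
    · rintro ⟨x, hxZ, hx⟩ hg
      exact hxZ (Set.mem_biUnion hg hx)
  have hclosed : IsClosed Z :=
    (isOpen_biUnion fun h _ => hA1.isOpen_principalOpen B h).isClosed_compl
  have hirr : IsIrreducible Z := by
    refine ⟨?_, fun u v hu hv => ?_⟩
    · exact ((hZ 1).1 hp.one_notMem).mono Set.inter_subset_left
    · rintro ⟨x, hxZ, hxu⟩ ⟨y, hyZ, hyv⟩
      obtain ⟨a, hxa, ha⟩ := hA1.exists_principalOpen_subset hxu hu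
      obtain ⟨b, hyb, hb⟩ := hA1.exists_principalOpen_subset hyv hv
      have hab := (hZ (a * b)).1
        (hp.mul_notMem a b ((hZ a).2 ⟨x, hxZ, hxa⟩) ((hZ b).2 ⟨y, hyZ, hyb⟩))
      rw [hA1.principalOpen_mul] at hab
      exact hab.mono (Set.inter_subset_inter_right _ (Set.inter_subset_inter ha hb))
  obtain ⟨z, hz, -⟩ := hA4 _ Z hirr hclosed
  refine ⟨z, Set.ext fun g => ?_⟩
  -- An open set meets `Z = closure {z}` exactly when it contains `z`.
  rw [hA1.mem_pointIdeal_iff, not_iff_comm, hZ, ← hz,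
    closure_inter_open_nonempty_iff (hA1.isOpen_principalOpen B g), Set.singleton_inter_nonempty]

end Topology
end Bands

theorem mainTheorem4 (F : Bands.BAff.{u} ⥤ TopCat.{u})
    (hA1 : Bands.AxiomA1 F) (hA2 : Bands.AxiomA2 F) (hA3 : Bands.AxiomA3 F) :
    -- every affine open subscheme is principal open
    (∀ (B : Bands.BandCat.{u}) (V : Bands.BAff.{u}) (φ : V ⟶ Bands.Spec B),
      Bands.IsOpenImmersion F φ →
        ∃ (h : B.carrier) (e : V ≅ Bands.Spec (Bands.finLoc B h)),
          e.hom ≫ Bands.principal B h = φ) ∧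
    -- a family of open immersions covers if and only if one of its members is an isomorphism
    -- (or if it is the empty family over the empty space)
    (∀ (X : Bands.BAff.{u}) (I : Type u) (U : I → Bands.BAff.{u}) (φ : ∀ i, U i ⟶ X),
      (∀ i, Bands.IsOpenImmersion F (φ i)) →
        (Bands.IsCoveringFamily F φ ↔
          (∃ i, IsIso (φ i)) ∨ (IsEmpty I ∧ IsEmpty (F.obj X)))) ∧
    -- points of `Spec B` and prime `m`-ideals of `B`
    (Bands.AxiomA4 F → Bands.TrivialSpecEmpty F →
      ∀ B : Bands.BandCat.{u},
        (∀ x : F.obj (Bands.Spec B),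
          (Submonoid.closure (Bands.stalkSet F B x) : Set B.carrier) = Bands.stalkSet F B x) ∧
        Set.BijOn (Bands.pointIdeal F B) Set.univ {p | Bands.IsPrimeMIdeal p} ∧
        ∀ h : B.carrier, Bands.pointIdeal F B '' Bands.principalOpen F B h =
          {p | Bands.IsPrimeMIdeal p ∧ h ∉ p}) := by

  refine ⟨fun B V φ hφ => Bands.exists_iso_principal hA1 hA3 hφ,
    fun X I U φ hφ => Bands.isCoveringFamily_iff hA1 hA3 hφ, fun hA4 hF B => ?_⟩
  refine ⟨hA1.closure_stalkSet B, ⟨fun x _ => hA1.isPrimeMIdeal_pointIdeal hF x,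
    (Bands.pointIdeal_injective hA1 hA4 B).injOn, fun p hp => ?_⟩, fun h => Set.ext fun p => ?_⟩
  · obtain ⟨x, hx⟩ := Bands.exists_pointIdeal_eq hA1 hA3 hA4 hp
    exact ⟨x, trivial, hx⟩
  · constructor
    · rintro ⟨x, hx, rfl⟩
      exact ⟨hA1.isPrimeMIdeal_pointIdeal hF x, fun hh => hA1.mem_pointIdeal_iff.1 hh hx⟩
    · rintro ⟨hp, hh⟩
      obtain ⟨x, rfl⟩ := Bands.exists_pointIdeal_eq hA1 hA3 hA4 hp
      exact ⟨x, not_not.1 fun hx => hh (hA1.mem_pointIdeal_iff.2 hx), rfl⟩
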